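/- **Setting.** Let $G$ be a connected undirected simple graph on $\{1,\dots,n\}$ and let $\mathcal E$ be the set of its ordered edges (both $(i,j)$ and $(j,i)$ for each edge), $|\mathcal E|=q$. For $x=[x_1,\dots,x_n]\in\mathbb R^{np}$ let $(A_sx)_e=x_i$ and $(A_dx)_e=x_j$ for $e=(i,j)\in\mathcal E$, and put $A=[A_s;A_d]$, $B=[-I;-I]$, $E_u=A_s+A_d$, $E_o=A_s-A_d$. Let $\gamma_u$ and $\Gamma_u$ be the smallest and the largest singular value of $E_u$, and let $\gamma_o$ be the smallest nonzero singular value of $E_o$; assume $\gamma_u>0$. Let $f_1,\dots,f_n:\mathbb R^p\to\mathbb R$ and $f(x)=\sum_i f_i(x_i)$. For $c>0$, the DQM iterates $x_k\in\mathbb R^{np}$, $z_k\in\mathbb R^{qp}$, $\lambda_k=[\alpha_k;\beta_k]\in\mathbb R^{2qp}$ are given for $k\ge 0$ by $$x_{k+1}=\arg\min_x\ f(x_k)+\nabla f(x_k)^T(x-x_k)+\tfrac12(x-x_k)^T\nabla^2f(x_k)(x-x_k)+\lambda_k^T(Ax+Bz_k)+\tfrac c2\|Ax+Bz_k\|^2,$$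 $$z_{k+1}=\arg\min_z\ f(x_{k+1})+\lambda_k^T(Ax_{k+1}+Bz)+\tfrac c2\|Ax_{k+1}+Bz\|^2,\qquad \lambda_{k+1}=\lambda_k+c(Ax_{k+1}+Bz_{k+1}).$$ **Assumptions.** 1. $\alpha_0=-\beta_0$, $E_ux_0=2z_0$, and $\alpha_0$ lies in the column space of $E_o$. 2. Each $f_i$ is twice differentiable and $mI\preceq\nabla^2f_i(x)\preceq MI$ for all $x\in\mathbb R^p$, where $0<m\le M<\infty$. 3. $\|\nabla^2f_i(x)-\nabla^2f_i(\hat x)\|\le L\|x-\hat x\|$ for all $i$ and all $x,\hat x\in\mathbb R^p$. Let $(x^*,z^*)$ be the solution of $\min f(x)$ subject to $Ax+Bz=0$, and let $\alpha^*$ be the optimal multiplier in the column space of $E_o$: for some $\beta^*$, the pair $(x^*,z^*)$ minimizes $f(x)+[\alpha^*;\beta^*]^T(Ax+Bz)$ over all $(x,z)$. Put $u_k=[z_k;\alpha_k]$, $u^*=[z^*;\alpha^*]$, $\|[z;\alpha]\|_C^2=c\|z\|^2+\tfrac1c\|\alpha\|^2$, and $\zeta_k=\min\{\tfrac L2\|x_{k+1}-x_k\|,\,2M\}$.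 Let $\mu,\mu'>1$, and define $$\delta(\zeta,\eta)=\min\left\{\frac{c-\eta\zeta\gamma_u^{-2}}{\frac{4\mu'\mu\zeta^2}{c(\mu'-1)(\mu-1)}\gamma_u^{-2}\gamma_o^{-2}+\frac{\mu'\mu}{\mu-1}\,c\,\Gamma_u^2\gamma_o^{-2}},\ \frac{m-\zeta/\eta}{\frac c4\Gamma_u^2+\frac\mu cM^2\gamma_o^{-2}}\right\}.$$ **Theorem.** Under Assumptions 1–3: (a) For every $k\ge0$, if $c>\zeta_k^2/(m\gamma_u^2)$ and $\eta>0$ lies in $(\zeta_k/m,\ c\gamma_u^2/\zeta_k)$ (the right end point being $+\infty$ if $\zeta_k=0$), then $\delta_k:=\delta(\zeta_k,\eta)>0$ and $$\|u_{k+1}-u^*\|_C^2\le\frac1{1+\delta_k}\|u_k-u^*\|_C^2.$$ (b) If $\zeta\ge\zeta_k$ for all $k$, $c>\zeta^2/(m\gamma_u^2)$, and $\eta>0$ lies in $(\zeta/m,\ c\gamma_u^2/\zeta)$ (the right end point being $+\infty$ if $\zeta=0$), then $\delta:=\delta(\zeta,\eta)>0$ and, for all $k\ge 0$, $\|u_{k+1}-u^*\|_C^2\le\frac1{1+\delta}\|u_k-u^*\|_C^2$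 and $\|u_k-u^*\|_C^2\le(1+\delta)^{-k}\|u_0-u^*\|_C^2$; so $\|u_k-u^*\|_C^2\to0$ linearly. (c) $\zeta_k\le2M$ for all $k$, so $\zeta=2M$ may be taken in (b), which gives a uniform rate. -/

import Mathlib

open scoped RealInnerProductSpace Topology

noncomputable section

namespace DQM

/-- Local variables: vectors of `ℝᵖ` with the Euclidean norm. -/
abbrev Loc (p : ℕ) : Type := EuclideanSpace ℝ (Fin p)

/-- Node variables `x = [x₁, …, xₙ] ∈ ℝⁿᵖ`, with the Euclidean norm. -/
abbrev NodeVec (n p : ℕ) : Type := PiLp 2 (fun _ : Fin n => Loc p)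

section Network

variable {n : ℕ} (G : SimpleGraph (Fin n)) [DecidableRel G.Adj] (p : ℕ)

/-- Edge variables `z = [z_e]_e`, one block of `ℝᵖ` for every ordered edge `e = (i, j)` of the
symmetric network (a dart of `G`), with the Euclidean norm. -/
abbrev EdgeVec : Type := PiLp 2 (fun _ : G.Dart => Loc p)

/-- Stacks `[a; b]` of two edge variables, with the Euclidean norm. -/
abbrev EdgePair : Type := WithLp 2 (EdgeVec G p × EdgeVec G p)

/-- The block source matrix: the block `(e, i)` is the identity iff `i` is the source of `e`. -/
def sourceMat : NodeVec n p →ₗ[ℝ] EdgeVec G p where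
  toFun x := WithLp.toLp 2 (fun e => x e.fst)
  map_add' _ _ := rfl
  map_smul' _ _ := rfl

/-- The block destination matrix: the block `(e, i)` is the identity iff `i` is the
destination of `e`. -/
def destMat : NodeVec n p →ₗ[ℝ] EdgeVec G p where
  toFun x := WithLp.toLp 2 (fun e => x e.snd)
  map_add' _ _ := rfl
  map_smul' _ _ := rfl

/-- The unoriented incidence matrix `E_u = A_s + A_d`. -/
def unorientedInc : NodeVec n p →ₗ[ℝ] EdgeVec G p := sourceMat G p + destMat G p

/-- The oriented incidence matrix `E_o = A_s - A_d`. -/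
def orientedInc : NodeVec n p →ₗ[ℝ] EdgeVec G p := sourceMat G p - destMat G p

/-- The constraint residual `A x + B z`, where `A = [A_s; A_d]` and `B = [-I; -I]`. -/
def residual (x : NodeVec n p) (z : EdgeVec G p) : EdgePair G p :=
  WithLp.toLp 2 (sourceMat G p x - z, destMat G p x - z)

/-- `γ_u`: the smallest of the `np` singular values of `E_u` (singular values are listed in
decreasing order, starting from the index `0`). -/
def gammaU : ℝ :=
  (unorientedInc G p).singularValues (Module.finrank ℝ (NodeVec n p) - 1)

/-- `Γ_u`: the largest singular value of `E_u`. -/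
def GammaU : ℝ := (unorientedInc G p).singularValues 0

/-- `γ_o`: the smallest nonzero singular value of `E_o` (the nonzero singular values are those
with an index smaller than the rank). -/
def gammaO : ℝ :=
  (orientedInc G p).singularValues (Module.finrank ℝ (LinearMap.range (orientedInc G p)) - 1)

end Network

/-- The Hessian of a real function on a Euclidean space: the derivative of its gradient. -/
def hessian {E : Type*} [NormedAddCommGroup E] [InnerProductSpace ℝ E] [CompleteSpace E]
    (f : E → ℝ) (x : E) : E →L[ℝ] E :=
  fderiv ℝ (gradient f) x

/-- `f` is twice differentiable everywhere. -/
def TwiceDifferentiable {E : Type*} [NormedAddCommGroup E] [InnerProductSpace ℝ E]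
    [CompleteSpace E] (f : E → ℝ) : Prop :=
  Differentiable ℝ f ∧ Differentiable ℝ (gradient f)

/-- The aggregate objective `f(x) = ∑ᵢ fᵢ(xᵢ)`. -/
def aggregate {n p : ℕ} (f : Fin n → Loc p → ℝ) (x : NodeVec n p) : ℝ := ∑ i, f i (x i)

/-- The local functions are twice differentiable, and the eigenvalues of their Hessians lie in
`[m, M]`, that is, `m I ⪯ ∇²fᵢ(x) ⪯ M I` in the order of symmetric operators. -/
def HessianBounds {n p : ℕ} (f : Fin n → Loc p → ℝ) (m M : ℝ) : Prop :=
  ∀ i, TwiceDifferentiable (f i) ∧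
    ∀ x, m • (1 : Loc p →L[ℝ] Loc p) ≤ hessian (f i) x ∧
      hessian (f i) x ≤ M • (1 : Loc p →L[ℝ] Loc p)

/-- The local Hessians are Lipschitz continuous with parameter `L` in the operator norm. -/
def HessianLipschitz {n p : ℕ} (f : Fin n → Loc p → ℝ) (L : ℝ) : Prop :=
  ∀ i, ∀ x y, ‖hessian (f i) x - hessian (f i) y‖ ≤ L * ‖x - y‖

section Problem

variable {n p : ℕ} (G : SimpleGraph (Fin n)) [DecidableRel G.Adj] (f : Fin n → Loc p → ℝ)

/-- `(x, z)` solves: minimize `f(x)` subject to `A x + B z = 0`. -/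
def IsSolution (x : NodeVec n p) (z : EdgeVec G p) : Prop :=
  residual G p x z = 0 ∧
    ∀ (x' : NodeVec n p) (z' : EdgeVec G p), residual G p x' z' = 0 →
      aggregate f x ≤ aggregate f x'

/-- `lam` is an optimal Lagrange multiplier of the problem with solution `(x, z)`: the pair
`(x, z)` minimizes the Lagrangian `f(x') + lamᵀ (A x' + B z')` over all `(x', z')`. -/
def IsOptimalMultiplier (x : NodeVec n p) (z : EdgeVec G p) (lam : EdgePair G p) : Prop :=
  ∀ (x' : NodeVec n p) (z' : EdgeVec G p),
    aggregate f x + ⟪lam, residual G p x z⟫ ≤ aggregate f x' + ⟪lam, residual G p x' z'⟫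

/-- The objective of the DQM update of `x`: the second order model of the aggregate objective
at `xk`, plus the multiplier term and the penalty term. -/
def xObjective (c : ℝ) (xk : NodeVec n p) (zk : EdgeVec G p) (lamk : EdgePair G p)
    (x : NodeVec n p) : ℝ :=
  aggregate f xk + ⟪gradient (aggregate f) xk, x - xk⟫
    + (1 / 2) * ⟪x - xk, hessian (aggregate f) xk (x - xk)⟫
    + ⟪lamk, residual G p x zk⟫ + (c / 2) * ‖residual G p x zk‖ ^ 2

/-- The augmented Lagrangian, minimized over `z` in the update of `z`. -/
def augLagrangian (c : ℝ) (x : NodeVec n p) (z : EdgeVec G p) (lam : EdgePair G p) : ℝ :=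
  aggregate f x + ⟪lam, residual G p x z⟫ + (c / 2) * ‖residual G p x z‖ ^ 2

/-- The sequences `x`, `z`, `lam` are generated by DQM with parameter `c`. -/
structure IsDQM (c : ℝ) (x : ℕ → NodeVec n p) (z : ℕ → EdgeVec G p)
    (lam : ℕ → EdgePair G p) : Prop where
  x_update : ∀ k, IsMinOn (xObjective G f c (x k) (z k) (lam k)) Set.univ (x (k + 1))
  z_update : ∀ k,
    IsMinOn (fun w => augLagrangian G f c (x (k + 1)) w (lam k)) Set.univ (z (k + 1))
  lam_update : ∀ k, lam (k + 1) = lam k + c • residual G p (x (k + 1)) (z (k + 1))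

/-- The conditions on the initial values, for `lam₀ = [α₀; β₀]`:
`α₀ = -β₀`, `E_u x₀ = 2 z₀`, and `α₀` lies in the column space of `E_o`. -/
structure InitialCondition (x₀ : NodeVec n p) (z₀ : EdgeVec G p) (lam₀ : EdgePair G p) :
    Prop where
  mult : lam₀.fst = -lam₀.snd
  primal : unorientedInc G p x₀ = (2 : ℝ) • z₀
  col : lam₀.fst ∈ LinearMap.range (orientedInc G p)

variable {G}

/-- The weighted squared norm `‖u‖_C² = uᵀ C u` of `u = [z; α]`, with
`C = diag(c I, (1/c) I)`. -/
def sqNormC (c : ℝ) (u : EdgePair G p) : ℝ :=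
  ⟪u, (WithLp.toLp 2 (c • u.fst, (1 / c) • u.snd) : EdgePair G p)⟫

end Problem

/-- `ζ_k = min {(L/2) ‖x_{k+1} - x_k‖, 2M}`. -/
def zeta {n p : ℕ} (L M : ℝ) (x : ℕ → NodeVec n p) (k : ℕ) : ℝ :=
  min ((L / 2) * ‖x (k + 1) - x k‖) (2 * M)

/-- The rate `δ` as a function of all the constants it depends on; `gu`, `Gu`, `go` stand for
`γ_u`, `Γ_u`, `γ_o`. -/
def delta (c η ζ μ μ' m M gu Gu go : ℝ) : ℝ :=
  min
    ((c - η * ζ * (gu ^ 2)⁻¹) /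
      (4 * μ' * μ * ζ ^ 2 / (c * (μ' - 1) * (μ - 1)) * (gu ^ 2)⁻¹ * (go ^ 2)⁻¹
        + μ' * μ / (μ - 1) * c * Gu ^ 2 * (go ^ 2)⁻¹))
    ((m - ζ / η) / (c / 4 * Gu ^ 2 + μ / c * M ^ 2 * (go ^ 2)⁻¹))

end DQM

end

/-! Minimality in `z` forces every multiplier into the form `[α; -α]`. The multiplier update then
yields `E_u x = 2z` and `α_{k+1} = α_k + (c/2) E_o x_{k+1}`. Subtracting the optimality condition at
`(x*, α*)` from stationarity in `x` gives `g + e + E_oᵀ a + c E_uᵀ dz = 0`, where `g` is the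
gradient difference, `e` the error of the quadratic model, `a` the dual error and `dz` the increment
of `z`.

Everything follows from this equation (`one_step_contraction`), tested twice. Tested with the primal
error `dx`, it shows by polarization and strong monotonicity that the squared `C`-norm drops by at
least `(m - ζ/η)‖dx‖² + (c - ηζ/γ_u²)‖dz‖²`. Tested with a minimal-norm preimage of `a` under `E_o`,
it bounds `‖a‖` by `‖dx‖` and `‖dz‖`; the iteration keeps `α` in the column space of `E_o`, so such
a preimage exists. Hence the drop is at least `δ` times the new squared error, `δ` being the smaller
of the two coefficient ratios. The bound on `e` is `norm_gradient_model_error_le`. -/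

noncomputable section

namespace DQM

/-! ### Norm bounds from singular values. -/

section SingularValues

variable {E F : Type*} [NormedAddCommGroup E] [InnerProductSpace ℝ E] [FiniteDimensional ℝ E]
  [NormedAddCommGroup F] [InnerProductSpace ℝ F] [FiniteDimensional ℝ F] (T : E →ₗ[ℝ] F)

/-- An orthonormal basis of right singular vectors of `T`. -/
def rightSingularBasis : OrthonormalBasis (Fin (Module.finrank ℝ E)) ℝ E :=
  T.isSymmetric_adjoint_comp_self.eigenvectorBasis rfl

/-- `‖T x‖² = ⟪T*T x, x⟫`, and `T*T` is diagonal in the chosen basis with the squared singular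
values as eigenvalues. -/
lemma norm_sq_map_eq_sum (x : E) :
    ‖T x‖ ^ 2 = ∑ i : Fin (Module.finrank ℝ E), T.singularValues i ^ 2 * (rightSingularBasis T).repr x i ^ 2 := by
  have h1 : ‖T x‖ ^ 2 = ⟪(LinearMap.adjoint T ∘ₗ T) x, x⟫ := by
    rw [LinearMap.comp_apply, LinearMap.adjoint_inner_left, real_inner_self_eq_norm_sq]
  rw [h1, ← (rightSingularBasis T).repr.inner_map_map, PiLp.inner_apply]
  refine Finset.sum_congr rfl fun i _ => ?_
  have h2 := T.isSymmetric_adjoint_comp_self.eigenvectorBasis_apply_self_apply rfl x i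
  have h3 := T.sq_singularValues_fin rfl i
  rw [h3]
  change _ = T.isSymmetric_adjoint_comp_self.eigenvalues rfl i * _ at h2
  simp only [rightSingularBasis]
  rw [h2]
  simp
  ring

lemma norm_sq_eq_sum_repr (x : E) :
    ‖x‖ ^ 2 = ∑ i, (rightSingularBasis T).repr x i ^ 2 := by
  rw [← (rightSingularBasis T).repr.norm_map, EuclideanSpace.norm_sq_eq]
  simp

lemma norm_map_le_singularValues_zero_mul (x : E) : ‖T x‖ ≤ T.singularValues 0 * ‖x‖ := by
  refine le_of_sq_le_sq ?_ (mul_nonneg (T.singularValues_nonneg 0) (norm_nonneg x))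
  rw [mul_pow, norm_sq_map_eq_sum, norm_sq_eq_sum_repr T, Finset.mul_sum]
  refine Finset.sum_le_sum fun i _ => mul_le_mul_of_nonneg_right ?_ (sq_nonneg _)
  exact pow_le_pow_left₀ (T.singularValues_nonneg _) (T.singularValues_antitone (Nat.zero_le _)) 2

lemma singularValues_last_mul_le_norm_map (x : E) :
    T.singularValues (Module.finrank ℝ E - 1) * ‖x‖ ≤ ‖T x‖ := by
  refine le_of_sq_le_sq ?_ (norm_nonneg _)
  rw [mul_pow, norm_sq_map_eq_sum, norm_sq_eq_sum_repr T, Finset.mul_sum]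
  refine Finset.sum_le_sum fun i _ => mul_le_mul_of_nonneg_right ?_ (sq_nonneg _)
  exact pow_le_pow_left₀ (T.singularValues_nonneg _)
    (T.singularValues_antitone (Nat.le_sub_one_of_lt i.isLt)) 2

/-- On the orthogonal complement of the kernel, a linear map expands at least by its smallest
nonzero singular value. -/
lemma singularValues_rank_mul_le_norm_map {x : E} (hx : x ∈ (LinearMap.ker T)ᗮ) :
    T.singularValues (Module.finrank ℝ (LinearMap.range T) - 1) * ‖x‖ ≤ ‖T x‖ := by
  refine le_of_sq_le_sq ?_ (norm_nonneg _)
  rw [mul_pow, norm_sq_map_eq_sum, norm_sq_eq_sum_repr T, Finset.mul_sum]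
  refine Finset.sum_le_sum fun i _ => ?_
  by_cases hi : (i : ℕ) < Module.finrank ℝ (LinearMap.range T)
  · refine mul_le_mul_of_nonneg_right ?_ (sq_nonneg _)
    exact pow_le_pow_left₀ (T.singularValues_nonneg _)
      (T.singularValues_antitone (Nat.le_sub_one_of_lt hi)) 2
  -- Basis vectors with index at least the rank lie in the kernel, so `x` has no component along
  -- them.
  · have h0 : T.singularValues i = 0 :=
      T.singularValues_eq_zero_iff_le_finrank_range.2 (not_lt.1 hi)
    have hb : rightSingularBasis T i ∈ LinearMap.ker T := by
      rw [LinearMap.mem_ker, ← norm_eq_zero, ← sq_eq_zero_iff, norm_sq_map_eq_sum]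
      refine Finset.sum_eq_zero fun j _ => ?_
      by_cases hj : j = i
      · subst hj; simp [h0]
      · simp [OrthonormalBasis.repr_self, hj]
    have h1 : (rightSingularBasis T).repr x i = 0 := by
      rw [OrthonormalBasis.repr_apply_apply]
      exact (Submodule.mem_orthogonal _ _).1 hx _ hb
    simp [h1]

/-- Discarding the kernel component of any preimage leaves one on which `T` expands. -/
lemma exists_map_eq_of_mem_range {y : F} (hy : y ∈ LinearMap.range T) :
    ∃ x, T x = y ∧
      T.singularValues (Module.finrank ℝ (LinearMap.range T) - 1) * ‖x‖ ≤ ‖y‖ := by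
  obtain ⟨x, rfl⟩ := hy
  obtain ⟨k, hk, w, hw, rfl⟩ := (LinearMap.ker T).exists_add_mem_mem_orthogonal x
  have : T (k + w) = T w := by simp [LinearMap.mem_ker.1 hk]
  exact ⟨w, this.symm, this ▸ singularValues_rank_mul_le_norm_map T hw⟩

lemma singularValues_rank_pos {T : E →ₗ[ℝ] F} (hT : T ≠ 0) :
    0 < T.singularValues (Module.finrank ℝ (LinearMap.range T) - 1) := by
  rw [T.singularValues_pos_iff_lt_finrank_range]
  have : Module.finrank ℝ (LinearMap.range T) ≠ 0 := by
    rwa [Ne, Submodule.finrank_eq_zero, LinearMap.range_eq_bot]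
  omega

end SingularValues

/-! ### Gradient estimates from Hessian bounds. -/

section Smooth

lemma apply_eq_of_hasFDerivAt {E F : Type*} [NormedAddCommGroup E] [NormedSpace ℝ E]
    [NormedAddCommGroup F] [NormedSpace ℝ F] {f : E → F} {A B : E →L[ℝ] F} {x : E}
    (hA : HasFDerivAt f A x) (hB : HasFDerivAt f B x) (v : E) : A v = B v := by
  rw [hA.unique hB]

variable {E : Type*} [NormedAddCommGroup E] [InnerProductSpace ℝ E]

lemma norm_apply_le_of_nonneg_of_le {M : ℝ} (hM : 0 < M) {H : E →L[ℝ] E} (h0 : 0 ≤ H)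
    (h1 : H ≤ M • (1 : E →L[ℝ] E)) (v : E) : ‖H v‖ ≤ M * ‖v‖ := by
  rw [ContinuousLinearMap.nonneg_iff_isPositive] at h0
  have hle : ∀ w, ⟪H w, w⟫ ≤ M * ‖w‖ ^ 2 := fun w => by
    have := ((ContinuousLinearMap.le_def _ _).1 h1).inner_nonneg_left w
    simp only [sub_apply, smul_apply,
      one_apply_eq_self, inner_sub_left, inner_smul_left,
      real_inner_self_eq_norm_sq] at this
    simpa using this
  -- Positivity at `M v - H v` expands to `M²⟪Hv, v⟫ - 2M‖Hv‖² + ⟪H(Hv), Hv⟫ ≥ 0`; bounding the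
  -- outer terms by `H ≤ M` leaves `M‖Hv‖² ≤ M³‖v‖²`.
  have h2 := h0.inner_nonneg_left (M • v - H v)
  have hs : ⟪H (H v), v⟫ = ‖H v‖ ^ 2 := by
    rw [h0.inner_left_eq_inner_right, real_inner_self_eq_norm_sq]
  simp only [map_sub, map_smul, inner_sub_left, inner_sub_right, inner_smul_left, inner_smul_right,
    real_inner_self_eq_norm_sq, hs, RCLike.conj_to_real] at h2
  have h3 := hle v
  have h4 := hle (H v)
  refine le_of_sq_le_sq ?_ (by positivity)
  rw [mul_pow]
  have h5 : M * ‖H v‖ ^ 2 ≤ M * (M ^ 2 * ‖v‖ ^ 2) := by nlinarith [sq_nonneg M]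
  exact le_of_mul_le_mul_left h5 hM

lemma hasDerivAt_line (x d : E) (t : ℝ) : HasDerivAt (fun s : ℝ => x + s • d) d t := by
  simpa using ((hasDerivAt_id t).smul_const d).const_add x

variable [CompleteSpace E] {f : E → ℝ} {m M L : ℝ}

lemma hasDerivAt_gradient_line (hf : TwiceDifferentiable f) (x d : E) (t : ℝ) :
    HasDerivAt (fun s : ℝ => gradient f (x + s • d)) (hessian f (x + t • d) d) t := by
  have h1 := hasDerivAt_line x d t
  exact (hf.2 (x + t • d)).hasFDerivAt.comp_hasDerivAt t h1

lemma strongly_monotone_gradient (hf : TwiceDifferentiable f)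
    (hm : ∀ x, m • (1 : E →L[ℝ] E) ≤ hessian f x) (x y : E) :
    m * ‖y - x‖ ^ 2 ≤ ⟪gradient f y - gradient f x, y - x⟫ := by
  set d := y - x
  have hd : ∀ t, HasDerivAt (fun s : ℝ => ⟪gradient f (x + s • d), d⟫)
      ⟪hessian f (x + t • d) d, d⟫ t := fun t => by
    simpa using (hasDerivAt_gradient_line hf x d t).inner ℝ (hasDerivAt_const t d)
  have h := mul_sub_le_image_sub_of_le_deriv (f := fun s : ℝ => ⟪gradient f (x + s • d), d⟫)
    (C := m * ‖d‖ ^ 2) (fun t => (hd t).differentiableAt) (fun t => by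
      rw [(hd t).deriv]
      have := ((ContinuousLinearMap.le_def _ _).1 (hm (x + t • d))).inner_nonneg_left d
      simp only [sub_apply, smul_apply,
        one_apply_eq_self, inner_sub_left, inner_smul_left,
        real_inner_self_eq_norm_sq] at this
      simpa using this) zero_le_one
  simpa [d, inner_sub_left] using h

lemma norm_gradient_sub_le (hf : TwiceDifferentiable f) (hb : ∀ x v, ‖hessian f x v‖ ≤ M * ‖v‖)
    (x y : E) : ‖gradient f y - gradient f x‖ ≤ M * ‖y - x‖ := by
  have h := norm_image_sub_le_of_norm_deriv_le_segment_01'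
    (f := fun s : ℝ => gradient f (x + s • (y - x)))
    (fun t _ => (hasDerivAt_gradient_line hf x (y - x) t).hasDerivWithinAt)
    (fun t _ => hb (x + t • (y - x)) (y - x))
  simpa using h

lemma norm_gradient_taylor_le (hf : TwiceDifferentiable f)
    (hL : ∀ x y, ‖hessian f x - hessian f y‖ ≤ L * ‖x - y‖) (x y : E) :
    ‖gradient f y - gradient f x - hessian f x (y - x)‖ ≤ L / 2 * ‖y - x‖ * ‖y - x‖ := by
  set d := y - x
  have hd : ∀ t, HasDerivAt
      (fun s : ℝ => gradient f (x + s • d) - gradient f x - s • hessian f x d)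
      ((hessian f (x + t • d) - hessian f x) d) t := fun t => by
    refine (((hasDerivAt_gradient_line hf x d t).sub_const (gradient f x)).sub
      ((hasDerivAt_id t).smul_const (hessian f x d))).congr_deriv ?_
    simp
  -- A comparison function whose derivative dominates that of the remainder; this replaces
  -- integrating the Hessian along the segment.
  have hB : ∀ t : ℝ, HasDerivAt (fun s : ℝ => L / 2 * ‖d‖ * ‖d‖ * s ^ 2)
      (L * ‖d‖ * ‖d‖ * t) t := fun t => by
    refine ((hasDerivAt_pow 2 t).const_mul (L / 2 * ‖d‖ * ‖d‖)).congr_deriv ?_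
    push_cast; ring
  have h := image_norm_le_of_norm_deriv_right_le_deriv_boundary (a := 0) (b := 1)
    (fun t _ => (hd t).continuousAt.continuousWithinAt)
    (fun t _ => (hd t).hasDerivWithinAt) (by simp) hB
    (fun t ht => by
      refine (ContinuousLinearMap.le_opNorm _ _).trans ?_
      have := hL (x + t • d) x
      rw [add_sub_cancel_left, norm_smul, Real.norm_of_nonneg ht.1] at this
      calc _ ≤ L * (t * ‖d‖) * ‖d‖ := by gcongr
        _ = _ := by ring) (Set.right_mem_Icc.2 zero_le_one)
  simpa [d] using h

end Smooth

/-! ### Positivity of the rate and the Young inequalities behind its denominators. -/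

section Rate

variable {c η ζ μ μ' m M gu Gu go : ℝ}

/-- The denominator of the first term of `delta`. -/
def dualDenom (c ζ μ μ' gu Gu go : ℝ) : ℝ :=
  4 * μ' * μ * ζ ^ 2 / (c * (μ' - 1) * (μ - 1)) * (gu ^ 2)⁻¹ * (go ^ 2)⁻¹
    + μ' * μ / (μ - 1) * c * Gu ^ 2 * (go ^ 2)⁻¹

/-- The denominator of the second term of `delta`. -/
def primalDenom (c μ M Gu go : ℝ) : ℝ := c / 4 * Gu ^ 2 + μ / c * M ^ 2 * (go ^ 2)⁻¹

lemma dualDenom_pos (hc : 0 < c) (hμ : 1 < μ) (hμ' : 1 < μ') (hGu : 0 < Gu) (hgo : 0 < go) :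
    0 < dualDenom c ζ μ μ' gu Gu go := by
  have h1 := sub_pos.2 hμ
  have h2 := sub_pos.2 hμ'
  unfold dualDenom
  positivity

lemma primalDenom_pos (hc : 0 < c) (hμ : 1 < μ) (hGu : 0 < Gu) :
    0 < primalDenom c μ M Gu go := by
  unfold primalDenom
  positivity

lemma sub_div_pos_of_div_lt (hm : 0 < m) (hη : 0 < η) (h : ζ / m < η) : 0 < m - ζ / η := by
  rw [sub_pos, div_lt_iff₀ hη, mul_comm]
  exact (div_lt_iff₀ hm).1 h

lemma sub_mul_inv_sq_pos (hgu : 0 < gu) (h : η * ζ < c * gu ^ 2) :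
    0 < c - η * ζ * (gu ^ 2)⁻¹ := by
  rw [sub_pos, ← div_eq_mul_inv, div_lt_iff₀ (by positivity)]
  exact h

lemma delta_pos (hc : 0 < c) (hm : 0 < m) (hμ : 1 < μ) (hμ' : 1 < μ') (hη : 0 < η) (hgu : 0 < gu)
    (hGu : 0 < Gu) (hgo : 0 < go) (h1 : ζ / m < η) (h2 : η * ζ < c * gu ^ 2) :
    0 < delta c η ζ μ μ' m M gu Gu go :=
  lt_min (div_pos (sub_mul_inv_sq_pos hgu h2) (dualDenom_pos hc hμ hμ' hGu hgo))
    (div_pos (sub_div_pos_of_div_lt hm hη h1) (primalDenom_pos hc hμ hGu))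

lemma add_sq_le_young (hμ : 1 < μ) (p q : ℝ) :
    (p + q) ^ 2 ≤ μ * p ^ 2 + μ / (μ - 1) * q ^ 2 := by
  have h1 := sub_pos.2 hμ
  have : μ * p ^ 2 + μ / (μ - 1) * q ^ 2 - (p + q) ^ 2
      = ((μ - 1) * p - q) ^ 2 / (μ - 1) := by
    field_simp; ring
  have h2 : 0 ≤ ((μ - 1) * p - q) ^ 2 / (μ - 1) := by positivity
  linarith

/-- Young's inequality is applied twice: `μ` splits off `M * X`, then `μ'` separates `ζ * s` from `c
* Gu * y`. Eliminating `s` through `hs` produces the factor 4 in `dualDenom`. -/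
lemma sq_div_le_of_dual_bound (hc : 0 < c) (hμ : 1 < μ) (hμ' : 1 < μ')
    (hgu : 0 < gu) (hgo : 0 < go) {a X s y : ℝ} (ha0 : 0 ≤ a) (hs0 : 0 ≤ s)
    (ha : go * a ≤ M * X + (ζ * s + c * Gu * y)) (hs : gu * s ≤ 2 * y) :
    1 / c * a ^ 2 ≤ μ / c * M ^ 2 * (go ^ 2)⁻¹ * X ^ 2 + dualDenom c ζ μ μ' gu Gu go * y ^ 2 := by
  have h1 := sub_pos.2 hμ
  have h2 := sub_pos.2 hμ'
  have hy1 := add_sq_le_young hμ (M * X) (ζ * s + c * Gu * y)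
  have hy2 : (ζ * s + c * Gu * y) ^ 2
      ≤ μ' / (μ' - 1) * (ζ * s) ^ 2 + μ' * (c * Gu * y) ^ 2 := by
    have := add_sq_le_young hμ' (c * Gu * y) (ζ * s)
    rw [add_comm (ζ * s)]; linarith
  have hs2 : s ^ 2 ≤ 4 * (gu ^ 2)⁻¹ * y ^ 2 := by
    have := pow_le_pow_left₀ (mul_nonneg hgu.le hs0) hs 2
    rw [mul_comm 4, mul_assoc, ← div_eq_inv_mul, le_div_iff₀ (by positivity)]
    nlinarith
  have ha2 : a ^ 2 ≤ (go ^ 2)⁻¹ * (M * X + (ζ * s + c * Gu * y)) ^ 2 := by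
    have := pow_le_pow_left₀ (mul_nonneg hgo.le ha0) ha 2
    rw [← div_eq_inv_mul, le_div_iff₀ (by positivity)]
    nlinarith
  calc 1 / c * a ^ 2
      ≤ 1 / c * ((go ^ 2)⁻¹ * (μ * (M * X) ^ 2 + μ / (μ - 1) *
          (μ' / (μ' - 1) * (ζ ^ 2 * (4 * (gu ^ 2)⁻¹ * y ^ 2)) + μ' * (c * Gu * y) ^ 2))) := by
        gcongr
        refine ha2.trans ?_
        gcongr
        refine hy1.trans ?_
        gcongr
        refine hy2.trans ?_
        rw [mul_pow]
        gcongr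
    _ = _ := by
        unfold dualDenom
        field_simp

end Rate

/-! ### The abstract contraction estimate. -/

section OneStep

variable {X Z : Type*} [NormedAddCommGroup X] [InnerProductSpace ℝ X]
  [NormedAddCommGroup Z] [InnerProductSpace ℝ Z] {c η ζ μ μ' m M gu Gu go : ℝ}

/-- Contraction of the error in one step of a perturbed primal-dual iteration. Here `dx`, `b`, `a`
are the errors of the new primal, edge and dual variables, `ds`, `dz`, `da` the increments of the
step, `g` the difference of the gradients and `e` the error of the second order model. -/
lemma one_step_contraction (U O : X →ₗ[ℝ] Z) (hc : 0 < c) (hm : 0 < m) (hM : 0 < M) (hμ : 1 < μ)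
    (hμ' : 1 < μ') (hη : 0 < η) (hζ : 0 ≤ ζ) (hgu : 0 < gu) (hGu : 0 < Gu) (hgo : 0 < go)
    (h1 : ζ / m < η) (h2 : η * ζ < c * gu ^ 2)
    (hUl : ∀ v, gu * ‖v‖ ≤ ‖U v‖) (hUu : ∀ v, ‖U v‖ ≤ Gu * ‖v‖)
    {g e dx ds : X} {a da b dz : Z}
    (hstat : ∀ v, ⟪g + e, v⟫ + ⟪a, O v⟫ + c * ⟪dz, U v⟫ = 0)
    (hO : da = (c / 2) • O dx) (hU : U dx = (2 : ℝ) • b) (hUs : U ds = (2 : ℝ) • dz)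
    (he : ‖e‖ ≤ ζ * ‖ds‖) (hgM : ‖g‖ ≤ M * ‖dx‖) (hgm : m * ‖dx‖ ^ 2 ≤ ⟪g, dx⟫)
    (ha : ∃ v, O v = a ∧ go * ‖v‖ ≤ ‖a‖) :
    c * ‖b‖ ^ 2 + 1 / c * ‖a‖ ^ 2 ≤ 1 / (1 + delta c η ζ μ μ' m M gu Gu go) *
      (c * ‖b - dz‖ ^ 2 + 1 / c * ‖a - da‖ ^ 2) := by
  have hds : gu * ‖ds‖ ≤ 2 * ‖dz‖ := by
    simpa [hUs, norm_smul] using hUl ds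
  have hb : 2 * ‖b‖ ≤ Gu * ‖dx‖ := by
    simpa [hU, norm_smul] using hUu dx
  -- Stationarity is tested with the short preimage of `a`, which turns `⟪a, O v⟫` into `‖a‖²`. One
  -- factor `‖a‖` is cancelled at the end, hence the separate case of zero norm.
  have hdual : go * ‖a‖ ≤ M * ‖dx‖ + (ζ * ‖ds‖ + c * Gu * ‖dz‖) := by
    obtain ⟨v, hv, hva⟩ := ha
    rcases (norm_nonneg a).eq_or_lt with h0 | h0
    · rw [← h0]; simp; positivity
    have h3 := hstat v
    rw [hv, real_inner_self_eq_norm_sq, inner_add_left] at h3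
    have h4 := neg_le_of_abs_le (abs_real_inner_le_norm g v)
    have h5 := neg_le_of_abs_le (abs_real_inner_le_norm e v)
    have h6 : -(‖dz‖ * (Gu * ‖v‖)) ≤ ⟪dz, U v⟫ :=
      (neg_le_neg (mul_le_mul_of_nonneg_left (hUu v) (norm_nonneg _))).trans
        (neg_le_of_abs_le (abs_real_inner_le_norm dz (U v)))
    have h7 : ‖a‖ ^ 2 ≤ (M * ‖dx‖ + (ζ * ‖ds‖ + c * Gu * ‖dz‖)) * ‖v‖ := by
      have := mul_le_mul_of_nonneg_left h6 hc.le
      have := mul_le_mul_of_nonneg_right hgM (norm_nonneg v)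
      have := mul_le_mul_of_nonneg_right he (norm_nonneg v)
      linarith
    have h8 : 0 ≤ M * ‖dx‖ + (ζ * ‖ds‖ + c * Gu * ‖dz‖) := by positivity
    refine le_of_mul_le_mul_right ?_ h0
    calc go * ‖a‖ * ‖a‖ = go * ‖a‖ ^ 2 := by ring
      _ ≤ go * ((M * ‖dx‖ + (ζ * ‖ds‖ + c * Gu * ‖dz‖)) * ‖v‖) := by gcongr
      _ = (M * ‖dx‖ + (ζ * ‖ds‖ + c * Gu * ‖dz‖)) * (go * ‖v‖) := by ring
      _ ≤ _ := by gcongr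
  have hkey := sq_div_le_of_dual_bound hc hμ hμ' hgu hgo (norm_nonneg a) (norm_nonneg ds)
    hdual hds
  have hcb : c * ‖b‖ ^ 2 ≤ c / 4 * Gu ^ 2 * ‖dx‖ ^ 2 := by
    have := pow_le_pow_left₀ (by positivity) hb 2
    nlinarith
  have hδ := delta_pos (M := M) hc hm hμ hμ' hη hgu hGu hgo h1 h2
  set δ := delta c η ζ μ μ' m M gu Gu go with hδdef
  have hD1 := dualDenom_pos (ζ := ζ) (gu := gu) hc hμ hμ' hGu hgo
  have hD2 := primalDenom_pos (M := M) (go := go) hc hμ hGu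
  have hδ1 : δ * dualDenom c ζ μ μ' gu Gu go ≤ c - η * ζ * (gu ^ 2)⁻¹ :=
    (le_div_iff₀ hD1).1 (min_le_left _ _)
  have hδ2 : δ * primalDenom c μ M Gu go ≤ m - ζ / η :=
    (le_div_iff₀ hD2).1 (min_le_right _ _)
  have herr : -(ζ / η * ‖dx‖ ^ 2 + η * ζ * (gu ^ 2)⁻¹ * ‖dz‖ ^ 2) ≤ ⟪e, dx⟫ := by
    have h3 := neg_le_of_abs_le (abs_real_inner_le_norm e dx)
    have h4 := mul_le_mul_of_nonneg_right he (norm_nonneg dx)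
    -- The weight `η / 4` absorbs the 4 from `‖ds‖² ≤ 4 gu⁻² ‖dz‖²`.
    have h5 : ‖ds‖ * ‖dx‖ ≤ 1 / η * ‖dx‖ ^ 2 + η / 4 * ‖ds‖ ^ 2 := by
      have : 1 / η * ‖dx‖ ^ 2 + η / 4 * ‖ds‖ ^ 2 - ‖ds‖ * ‖dx‖
          = (‖dx‖ - η / 2 * ‖ds‖) ^ 2 / η := by field_simp; ring
      have : 0 ≤ (‖dx‖ - η / 2 * ‖ds‖) ^ 2 / η := by positivity
      linarith
    have h6 : ‖ds‖ ^ 2 ≤ 4 * ((gu ^ 2)⁻¹ * ‖dz‖ ^ 2) := by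
      have := pow_le_pow_left₀ (by positivity) hds 2
      rw [← div_eq_inv_mul, ← mul_div_assoc, le_div_iff₀ (by positivity)]
      nlinarith
    have h7 : ζ * (‖ds‖ * ‖dx‖) ≤ ζ * (1 / η * ‖dx‖ ^ 2
        + η / 4 * (4 * ((gu ^ 2)⁻¹ * ‖dz‖ ^ 2))) := by
      gcongr
      exact h5.trans (by gcongr)
    have h8 : ζ * (1 / η * ‖dx‖ ^ 2 + η / 4 * (4 * ((gu ^ 2)⁻¹ * ‖dz‖ ^ 2)))
        = ζ / η * ‖dx‖ ^ 2 + η * ζ * (gu ^ 2)⁻¹ * ‖dz‖ ^ 2 := by ring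
    linarith
  -- Testing with `dx` supplies exactly the cross terms `2c⟪dz, b⟫` and `(2/c)⟪a, da⟫` of the
  -- expanded squares; the nonnegative `‖da‖² / c` is dropped.
  have hmono : c * ‖b‖ ^ 2 + 1 / c * ‖a‖ ^ 2 + ((m - ζ / η) * ‖dx‖ ^ 2
      + (c - η * ζ * (gu ^ 2)⁻¹) * ‖dz‖ ^ 2) ≤ c * ‖b - dz‖ ^ 2 + 1 / c * ‖a - da‖ ^ 2 := by
    have h3 := hstat dx
    have h4 : ⟪a, O dx⟫ = 2 / c * ⟪a, da⟫ := by
      rw [hO, inner_smul_right]; field_simp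
    rw [h4, hU, inner_smul_right, inner_add_left] at h3
    rw [norm_sub_sq_real, norm_sub_sq_real, real_inner_comm dz b]
    have h5 : 0 ≤ 1 / c * ‖da‖ ^ 2 := by positivity
    have h6 : 2 / c * ⟪a, da⟫ = 1 / c * (2 * ⟪a, da⟫) := by ring
    linarith
  have hsum : δ * (c * ‖b‖ ^ 2 + 1 / c * ‖a‖ ^ 2) ≤ (m - ζ / η) * ‖dx‖ ^ 2
      + (c - η * ζ * (gu ^ 2)⁻¹) * ‖dz‖ ^ 2 := by
    calc δ * (c * ‖b‖ ^ 2 + 1 / c * ‖a‖ ^ 2)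
        ≤ δ * (primalDenom c μ M Gu go * ‖dx‖ ^ 2
            + dualDenom c ζ μ μ' gu Gu go * ‖dz‖ ^ 2) := by
          refine mul_le_mul_of_nonneg_left ?_ hδ.le
          unfold primalDenom
          linarith
      _ = δ * primalDenom c μ M Gu go * ‖dx‖ ^ 2
            + δ * dualDenom c ζ μ μ' gu Gu go * ‖dz‖ ^ 2 := by ring
      _ ≤ _ := by gcongr
  rw [one_div_mul_eq_div (1 + δ), le_div_iff₀ (by positivity)]
  linarith

end OneStep

/-! ### The aggregate objective: block-diagonal Hessian and model error. -/

section Aggregate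

variable {n p : ℕ} {f : Fin n → Loc p → ℝ} {m M L : ℝ}

lemma norm_le_mul_of_forall_block {C : ℝ} (hC : 0 ≤ C) {v w : NodeVec n p}
    (h : ∀ i, ‖w i‖ ≤ C * ‖v i‖) : ‖w‖ ≤ C * ‖v‖ := by
  refine le_of_sq_le_sq ?_ (by positivity)
  rw [mul_pow, PiLp.norm_sq_eq_of_L2, PiLp.norm_sq_eq_of_L2, Finset.mul_sum]
  refine Finset.sum_le_sum fun i _ => ?_
  rw [← mul_pow]
  exact pow_le_pow_left₀ (norm_nonneg _) (h i) 2

lemma hasGradientAt_aggregate (hf : ∀ i, Differentiable ℝ (f i)) (x : NodeVec n p) :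
    HasGradientAt (aggregate f) (WithLp.toLp 2 fun i => gradient (f i) (x i)) x := by
  rw [hasGradientAt_iff_hasFDerivAt]
  have h : HasFDerivAt (fun y : NodeVec n p => ∑ i, f i (y i))
      (∑ i, (fderiv ℝ (f i) (x i)).comp (PiLp.proj 2 (fun _ : Fin n => Loc p) i)) x :=
    HasFDerivAt.fun_sum fun i _ =>
      (hf i (x i)).hasFDerivAt.comp x (PiLp.proj 2 (fun _ : Fin n => Loc p) i).hasFDerivAt
  refine h.congr_fderiv ?_
  ext v
  simp [PiLp.inner_apply, inner_gradient_left]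

lemma gradient_aggregate_apply (hf : ∀ i, Differentiable ℝ (f i)) (x : NodeVec n p) (i : Fin n) :
    gradient (aggregate f) x i = gradient (f i) (x i) := by
  rw [(hasGradientAt_aggregate hf x).gradient]

lemma twiceDifferentiable_aggregate (hf : ∀ i, TwiceDifferentiable (f i)) :
    TwiceDifferentiable (aggregate f) := by
  refine ⟨fun x => (hasGradientAt_aggregate (fun i => (hf i).1) x).differentiableAt, ?_⟩
  rw [differentiable_piLp]
  intro i
  simp only [gradient_aggregate_apply fun i => (hf i).1]
  exact (hf i).2.comp (PiLp.proj 2 (fun _ : Fin n => Loc p) i).differentiable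

/-- Both sides come from derivatives of `y ↦ ∇fᵢ(yᵢ)`, which are unique. -/
lemma hessian_aggregate_apply (hf : ∀ i, TwiceDifferentiable (f i)) (x v : NodeVec n p)
    (i : Fin n) : hessian (aggregate f) x v i = hessian (f i) (x i) (v i) := by
  have h1 : HasFDerivAt (fun y : NodeVec n p => gradient (f i) (y i))
      ((PiLp.proj (𝕜 := ℝ) 2 (fun _ : Fin n => Loc p) i).comp (hessian (aggregate f) x)) x := by
    simp only [← gradient_aggregate_apply fun i => (hf i).1]
    exact HasFDerivAt.comp (g := PiLp.proj (𝕜 := ℝ) 2 (fun _ : Fin n => Loc p) i) x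
      (PiLp.proj (𝕜 := ℝ) 2 (fun _ : Fin n => Loc p) i).hasFDerivAt
      ((twiceDifferentiable_aggregate hf).2 x).hasFDerivAt
  have h2 : HasFDerivAt (fun y : NodeVec n p => gradient (f i) (y i))
      ((hessian (f i) (x i)).comp (PiLp.proj 2 (fun _ : Fin n => Loc p) i)) x :=
    HasFDerivAt.comp (g := gradient (f i)) x ((hf i).2 (x i)).hasFDerivAt
      (PiLp.proj (𝕜 := ℝ) 2 (fun _ : Fin n => Loc p) i).hasFDerivAt
  exact apply_eq_of_hasFDerivAt h1 h2 v

lemma isPositive_of_forall_block {T : NodeVec n p →L[ℝ] NodeVec n p}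
    {S : Fin n → Loc p →L[ℝ] Loc p} (hS : ∀ i, (S i).IsPositive)
    (h : ∀ v i, T v i = S i (v i)) : T.IsPositive := by
  refine (ContinuousLinearMap.isPositive_iff T).2 ⟨fun v w => ?_, fun v => ?_⟩
  · simp only [ContinuousLinearMap.coe_coe, PiLp.inner_apply, h]
    exact Finset.sum_congr rfl fun i _ => (hS i).inner_left_eq_inner_right _ _
  · simp only [PiLp.inner_apply, h]
    exact Finset.sum_nonneg fun i _ => (hS i).inner_nonneg_left _

lemma le_hessian_aggregate (hf : HessianBounds f m M) (x : NodeVec n p) :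
    m • (1 : NodeVec n p →L[ℝ] NodeVec n p) ≤ hessian (aggregate f) x :=
  isPositive_of_forall_block (fun i => ((hf i).2 (x i)).1) fun v i => by
    simp [hessian_aggregate_apply fun i => (hf i).1]

lemma hessian_aggregate_le (hf : HessianBounds f m M) (x : NodeVec n p) :
    hessian (aggregate f) x ≤ M • (1 : NodeVec n p →L[ℝ] NodeVec n p) :=
  isPositive_of_forall_block (fun i => ((hf i).2 (x i)).2) fun v i => by
    simp [hessian_aggregate_apply fun i => (hf i).1]

lemma hessian_aggregate_nonneg (hm : 0 ≤ m) (hf : HessianBounds f m M) (x : NodeVec n p) :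
    0 ≤ hessian (aggregate f) x := by
  refine le_trans ?_ (le_hessian_aggregate hf x)
  rw [ContinuousLinearMap.nonneg_iff_isPositive]
  exact ContinuousLinearMap.isPositive_one.smul_of_nonneg hm

lemma norm_hessian_aggregate_sub_le (hL0 : 0 ≤ L) (hf : ∀ i, TwiceDifferentiable (f i))
    (hL : HessianLipschitz f L) (x y : NodeVec n p) :
    ‖hessian (aggregate f) x - hessian (aggregate f) y‖ ≤ L * ‖x - y‖ := by
  refine ContinuousLinearMap.opNorm_le_bound _ (by positivity) fun v => ?_
  refine norm_le_mul_of_forall_block (by positivity) fun i => ?_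
  have h : (hessian (aggregate f) x - hessian (aggregate f) y) v i
      = (hessian (f i) (x i) - hessian (f i) (y i)) (v i) := by
    simp [hessian_aggregate_apply hf]
  rw [h]
  refine (ContinuousLinearMap.le_opNorm _ _).trans ?_
  have h2 : ‖x i - y i‖ ≤ ‖x - y‖ := PiLp.norm_apply_le (x - y) i
  gcongr
  exact (hL i _ _).trans (by gcongr)

/-- The error of the second order model of the gradient. -/
lemma norm_gradient_model_error_le (hm : 0 < m) (hM : 0 < M) (hL0 : 0 ≤ L)
    (hf : HessianBounds f m M) (hL : HessianLipschitz f L) (x y : NodeVec n p) :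
    ‖gradient (aggregate f) x + hessian (aggregate f) x (y - x) - gradient (aggregate f) y‖
      ≤ min (L / 2 * ‖y - x‖) (2 * M) * ‖y - x‖ := by
  have hF := twiceDifferentiable_aggregate fun i => (hf i).1
  have hb : ∀ x v, ‖hessian (aggregate f) x v‖ ≤ M * ‖v‖ := fun x v =>
    norm_apply_le_of_nonneg_of_le hM (hessian_aggregate_nonneg hm.le hf x)
      (hessian_aggregate_le hf x) v
  rw [min_mul_of_nonneg _ _ (norm_nonneg _)]
  refine le_min ?_ ?_
  · have h := norm_gradient_taylor_le hF
      (norm_hessian_aggregate_sub_le hL0 (fun i => (hf i).1) hL) x y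
    have e : gradient (aggregate f) x + hessian (aggregate f) x (y - x) - gradient (aggregate f) y
        = -(gradient (aggregate f) y - gradient (aggregate f) x
          - hessian (aggregate f) x (y - x)) := by abel
    rw [e, norm_neg]
    exact h
  -- The cruder bound ignores cancellation: the gradient increment and the Hessian term each cost `M
  -- * ‖y - x‖`.
  · have h1 := norm_gradient_sub_le hF hb x y
    have h2 := hb x (y - x)
    calc _ = ‖hessian (aggregate f) x (y - x)
          - (gradient (aggregate f) y - gradient (aggregate f) x)‖ := by congr 1; abel
      _ ≤ _ := (norm_sub_le _ _).trans (by linarith)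

end Aggregate

/-! ### Incidence matrices of the network. -/

section Network

variable {n p : ℕ} (G : SimpleGraph (Fin n)) [DecidableRel G.Adj]

lemma gammaU_le_GammaU : gammaU G p ≤ GammaU G p :=
  LinearMap.singularValues_antitone _ (Nat.zero_le _)

lemma gammaU_mul_le (v : NodeVec n p) : gammaU G p * ‖v‖ ≤ ‖unorientedInc G p v‖ :=
  singularValues_last_mul_le_norm_map _ v

lemma le_GammaU_mul (v : NodeVec n p) : ‖unorientedInc G p v‖ ≤ GammaU G p * ‖v‖ :=
  norm_map_le_singularValues_zero_mul _ v

variable {G}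

/-- Rules out the degenerate cases (no edges, or `p = 0`), which `gammaO_pos` and the sign of `L`
depend on. -/
lemma exists_dart_of_gammaU_pos (hγ : 0 < gammaU G p) :
    ∃ (_ : G.Dart) (w : Loc p), w ≠ 0 := by
  have h : unorientedInc G p ≠ 0 := by
    intro h
    simp [gammaU, h] at hγ
  obtain ⟨v, hv⟩ : ∃ v, unorientedInc G p v ≠ 0 := by
    by_contra! h'
    exact h (LinearMap.ext h')
  obtain ⟨e, he⟩ : ∃ e, unorientedInc G p v e ≠ 0 := by
    by_contra! h'
    exact hv (PiLp.ext h')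
  exact ⟨e, _, he⟩

lemma gammaO_pos (hγ : 0 < gammaU G p) : 0 < gammaO G p := by
  obtain ⟨e, w, hw⟩ := exists_dart_of_gammaU_pos hγ
  refine singularValues_rank_pos fun h => hw ?_
  have h1 := congrArg (fun T => T (WithLp.toLp 2 (Pi.single e.fst w)) e) h
  change (Pi.single e.fst w : Fin n → Loc p) e.fst - (Pi.single e.fst w : Fin n → Loc p) e.snd = 0
    at h1
  simpa [e.fst_ne_snd.symm] using h1

lemma HessianLipschitz.nonneg {f : Fin n → Loc p → ℝ} {L : ℝ} (hL : HessianLipschitz f L)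
    (hγ : 0 < gammaU G p) : 0 ≤ L := by
  obtain ⟨e, w, hw⟩ := exists_dart_of_gammaU_pos hγ
  have h := (norm_nonneg _).trans (hL e.fst w 0)
  rw [sub_zero] at h
  exact nonneg_of_mul_nonneg_left h (norm_pos_iff.2 hw)

end Network

/-! ### First-order conditions. -/

section Optimality

/-- The discriminant is `a²`. Both update objectives are quadratic along lines, so this yields their
stationarity without differentiation. -/
lemma eq_zero_of_forall_quadratic_nonneg {a b : ℝ} (h : ∀ t : ℝ, 0 ≤ t * a + t ^ 2 * b) :
    a = 0 := by
  have := discrim_le_zero (a := b) (b := a) (c := 0) fun t => by linarith [h t]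
  rw [discrim] at this
  nlinarith

variable {n p : ℕ} {G : SimpleGraph (Fin n)}

lemma residual_add_smul_left (x v : NodeVec n p) (z : EdgeVec G p) (t : ℝ) :
    residual G p (x + t • v) z = residual G p x z
      + t • (WithLp.toLp 2 (sourceMat G p v, destMat G p v) : EdgePair G p) := by
  refine WithLp.ofLp_injective 2 (Prod.ext ?_ ?_) <;> simp [residual] <;> abel

lemma residual_add_smul_right (x : NodeVec n p) (z w : EdgeVec G p) (t : ℝ) :
    residual G p x (z + t • w) = residual G p x z
      + t • (-WithLp.toLp 2 (w, w) : EdgePair G p) := by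
  refine WithLp.ofLp_injective 2 (Prod.ext ?_ ?_) <;> simp [residual] <;> abel

variable [DecidableRel G.Adj] {f : Fin n → Loc p → ℝ} {c : ℝ}

lemma norm_add_smul_sq {E : Type*} [NormedAddCommGroup E] [InnerProductSpace ℝ E] (r d : E)
    (t : ℝ) : ‖r + t • d‖ ^ 2 = ‖r‖ ^ 2 + 2 * t * ⟪r, d⟫ + t ^ 2 * ‖d‖ ^ 2 := by
  rw [norm_add_sq_real, inner_smul_right, norm_smul, mul_pow, Real.norm_eq_abs, sq_abs]
  ring

lemma stationary_of_isMinOn_xObjective (hsymm : ∀ x, (hessian (aggregate f) x).IsSymmetric)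
    {xk y : NodeVec n p} {zk : EdgeVec G p} {lamk : EdgePair G p}
    (h : IsMinOn (xObjective G f c xk zk lamk) Set.univ y) (v : NodeVec n p) :
    ⟪gradient (aggregate f) xk + hessian (aggregate f) xk (y - xk), v⟫
      + ⟪lamk + c • residual G p y zk,
          (WithLp.toLp 2 (sourceMat G p v, destMat G p v) : EdgePair G p)⟫ = 0 := by
  set A : EdgePair G p := WithLp.toLp 2 (sourceMat G p v, destMat G p v)
  refine eq_zero_of_forall_quadratic_nonneg
    (b := 1 / 2 * ⟪v, hessian (aggregate f) xk v⟫ + c / 2 * ‖A‖ ^ 2) fun t => ?_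
  have h1 := isMinOn_iff.1 h (y + t • v) (Set.mem_univ _)
  have hs : ⟪y - xk, hessian (aggregate f) xk v⟫ = ⟪hessian (aggregate f) xk (y - xk), v⟫ :=
    (hsymm xk (y - xk) v).symm
  have hs2 : ⟪v, hessian (aggregate f) xk (y - xk)⟫ = ⟪hessian (aggregate f) xk (y - xk), v⟫ :=
    real_inner_comm _ _
  simp only [xObjective, residual_add_smul_left, norm_add_smul_sq, add_sub_right_comm, map_add,
    map_smul, inner_add_left, inner_add_right, inner_smul_left, inner_smul_right, hs, hs2,
    RCLike.conj_to_real] at h1 ⊢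
  simp only [A]
  linarith

lemma fst_add_snd_eq_zero_of_forall_inner {lam : EdgePair G p}
    (h : ∀ w : EdgeVec G p, ⟪lam, (-WithLp.toLp 2 (w, w) : EdgePair G p)⟫ = 0) :
    lam.fst + lam.snd = 0 := by
  have := h (lam.fst + lam.snd)
  rw [inner_neg_right, neg_eq_zero, WithLp.prod_inner_apply] at this
  change ⟪lam.fst, lam.fst + lam.snd⟫ + ⟪lam.snd, lam.fst + lam.snd⟫ = 0 at this
  rwa [← inner_add_left, inner_self_eq_zero] at this

/-- Stationarity in `z` reads `Bᵀ(lam + c(Ax + Bz)) = 0`, and the vector in brackets is the updated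
multiplier. -/
lemma multiplier_balance_of_isMinOn {x : NodeVec n p} {z : EdgeVec G p} {lam : EdgePair G p}
    (h : IsMinOn (fun w => augLagrangian G f c x w lam) Set.univ z) :
    (lam + c • residual G p x z).fst + (lam + c • residual G p x z).snd = 0 := by
  refine fst_add_snd_eq_zero_of_forall_inner fun w => ?_
  set B : EdgePair G p := -WithLp.toLp 2 (w, w)
  refine eq_zero_of_forall_quadratic_nonneg (b := c / 2 * ‖B‖ ^ 2) fun t => ?_
  have h1 := isMinOn_iff.1 h (z + t • w) (Set.mem_univ _)
  simp only [augLagrangian, residual_add_smul_right, norm_add_smul_sq, inner_add_left,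
    inner_add_right, inner_smul_left, inner_smul_right, RCLike.conj_to_real] at h1 ⊢
  simp only [B]
  linarith

lemma inner_stack_of_balance {a b : EdgeVec G p} (v : NodeVec n p) :
    ⟪(WithLp.toLp 2 (a + b, -a + b) : EdgePair G p),
      (WithLp.toLp 2 (sourceMat G p v, destMat G p v) : EdgePair G p)⟫
      = ⟪a, orientedInc G p v⟫ + ⟪b, unorientedInc G p v⟫ := by
  rw [WithLp.prod_inner_apply]
  simp only [orientedInc, unorientedInc, LinearMap.sub_apply, LinearMap.add_apply, inner_add_left,
    inner_add_right, inner_sub_right, inner_neg_left]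
  ring

lemma stationary_of_isOptimalMultiplier (hf : ∀ i, Differentiable ℝ (f i))
    {xs : NodeVec n p} {zs αs βs : EdgeVec G p}
    (h : IsOptimalMultiplier G f xs zs (WithLp.toLp 2 (αs, βs))) (v : NodeVec n p) :
    ⟪gradient (aggregate f) xs, v⟫ + ⟪αs, orientedInc G p v⟫ = 0 := by
  -- The Lagrangian is affine in `z`, so a minimizer exists only if its slope vanishes.
  have hbal : αs + βs = 0 := by
    refine fst_add_snd_eq_zero_of_forall_inner (lam := WithLp.toLp 2 (αs, βs)) fun w => ?_
    refine eq_zero_of_forall_quadratic_nonneg (b := 0) fun t => ?_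
    have h1 := h xs (zs + t • w)
    rw [residual_add_smul_right, inner_add_right, inner_smul_right] at h1
    linarith
  have hβ : βs = -αs := (neg_eq_of_add_eq_zero_right hbal).symm
  have hd : HasDerivAt (fun t : ℝ => aggregate f (xs + t • v) + t * ⟪αs, orientedInc G p v⟫)
      (⟪gradient (aggregate f) xs, v⟫ + 1 * ⟪αs, orientedInc G p v⟫) 0 := by
    have h2 : HasFDerivAt (aggregate f) (fderiv ℝ (aggregate f) xs) (xs + (0 : ℝ) • v) := by
      rw [zero_smul, add_zero]
      exact (hasGradientAt_aggregate hf xs).differentiableAt.hasFDerivAt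
    rw [inner_gradient_left]
    have h3 : HasDerivAt (fun t : ℝ => aggregate f (xs + t • v)) (fderiv ℝ (aggregate f) xs v) 0 := by
      have h1 := hasDerivAt_line xs v 0
      exact h2.comp_hasDerivAt (0 : ℝ) h1
    have h4 : HasDerivAt (fun t : ℝ => t * ⟪αs, orientedInc G p v⟫)
        (1 * ⟪αs, orientedInc G p v⟫) 0 := (hasDerivAt_id' (0 : ℝ)).mul_const _
    exact h3.fun_add h4
  have hmin : IsLocalMin
      (fun t : ℝ => aggregate f (xs + t • v) + t * ⟪αs, orientedInc G p v⟫) 0 := by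
    refine Filter.Eventually.of_forall fun t => ?_
    have h1 := h (xs + t • v) zs
    have h2 := inner_stack_of_balance (a := αs) (b := 0) v
    rw [add_zero, add_zero, inner_zero_left, add_zero] at h2
    rw [residual_add_smul_left, inner_add_right, inner_smul_right, hβ, h2] at h1
    simp only [zero_smul, add_zero, zero_mul]
    linarith
  simpa using hmin.hasDerivAt_eq_zero hd

end Optimality

/-! ### Reduced form of the DQM iteration. -/

variable {n p : ℕ} {G : SimpleGraph (Fin n)} [DecidableRel G.Adj] {f : Fin n → Loc p → ℝ}
  {m M L c : ℝ} {x : ℕ → NodeVec n p} {z : ℕ → EdgeVec G p} {lam : ℕ → EdgePair G p}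

section Iterates

lemma IsDQM.snd_eq_neg_fst (h : IsDQM G f c x z lam)
    (h0 : InitialCondition G (x 0) (z 0) (lam 0)) (k : ℕ) : (lam k).snd = -(lam k).fst := by
  cases k with
  | zero => rw [h0.mult, neg_neg]
  | succ k =>
    have := multiplier_balance_of_isMinOn (h.z_update k)
    rw [← h.lam_update k] at this
    exact (neg_eq_of_add_eq_zero_right this).symm

/-- Adding the two halves of the multiplier update cancels all multipliers and leaves `c(E_u x - 2z)
= 0`. -/
lemma IsDQM.unorientedInc_eq (h : IsDQM G f c x z lam) (hc : 0 < c)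
    (h0 : InitialCondition G (x 0) (z 0) (lam 0)) (k : ℕ) :
    unorientedInc G p (x k) = (2 : ℝ) • z k := by
  cases k with
  | zero => exact h0.primal
  | succ k =>
    have h1 := congrArg WithLp.fst (h.lam_update k)
    have h2 := congrArg WithLp.snd (h.lam_update k)
    change _ = (lam k).fst + c • (sourceMat G p (x (k + 1)) - z (k + 1)) at h1
    change _ = (lam k).snd + c • (destMat G p (x (k + 1)) - z (k + 1)) at h2
    rw [h.snd_eq_neg_fst h0 k, h.snd_eq_neg_fst h0 (k + 1), h1] at h2
    have h3 : c • (unorientedInc G p (x (k + 1)) - (2 : ℝ) • z (k + 1)) = 0 := by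
      have h4 := sub_eq_zero.2 h2.symm
      rw [← h4, unorientedInc, LinearMap.add_apply]
      module
    exact sub_eq_zero.1 ((smul_eq_zero.1 h3).resolve_left hc.ne')

lemma IsDQM.fst_succ (h : IsDQM G f c x z lam) (hc : 0 < c)
    (h0 : InitialCondition G (x 0) (z 0) (lam 0)) (k : ℕ) :
    (lam (k + 1)).fst = (lam k).fst + (c / 2) • orientedInc G p (x (k + 1)) := by
  have h1 := congrArg WithLp.fst (h.lam_update k)
  change _ = (lam k).fst + c • (sourceMat G p (x (k + 1)) - z (k + 1)) at h1
  have h2 : z (k + 1) = (1 / 2 : ℝ) • unorientedInc G p (x (k + 1)) := by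
    rw [h.unorientedInc_eq hc h0]; module
  rw [h1, h2, unorientedInc, orientedInc, LinearMap.add_apply, LinearMap.sub_apply]
  module

lemma IsDQM.fst_mem_range (h : IsDQM G f c x z lam) (hc : 0 < c)
    (h0 : InitialCondition G (x 0) (z 0) (lam 0)) (k : ℕ) :
    (lam k).fst ∈ LinearMap.range (orientedInc G p) := by
  induction k with
  | zero => exact h0.col
  | succ k ih =>
    rw [h.fst_succ hc h0]
    exact add_mem ih (Submodule.smul_mem _ _ (LinearMap.mem_range_self _ _))

lemma IsDQM.stationary (h : IsDQM G f c x z lam)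
    (h0 : InitialCondition G (x 0) (z 0) (lam 0))
    (hsymm : ∀ x, (hessian (aggregate f) x).IsSymmetric) (k : ℕ) (v : NodeVec n p) :
    ⟪gradient (aggregate f) (x k) + hessian (aggregate f) (x k) (x (k + 1) - x k), v⟫
      + ⟪(lam (k + 1)).fst, orientedInc G p v⟫
      + c * ⟪z (k + 1) - z k, unorientedInc G p v⟫ = 0 := by
  have h1 := stationary_of_isMinOn_xObjective hsymm (h.x_update k) v
  -- The `x`-update sees the old `z k`; passing to the new multiplier costs `c[dz; dz]` with `dz = z
  -- (k + 1) - z k`, the source of the `E_u` term.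
  have h2 : lam k + c • residual G p (x (k + 1)) (z k)
      = WithLp.toLp 2 ((lam (k + 1)).fst + c • (z (k + 1) - z k),
          -(lam (k + 1)).fst + c • (z (k + 1) - z k)) := by
    have h3 : lam k + c • residual G p (x (k + 1)) (z k)
        = lam (k + 1) + c • WithLp.toLp 2 (z (k + 1) - z k, z (k + 1) - z k) := by
      rw [h.lam_update k, add_assoc, ← smul_add]
      congr 2
      refine WithLp.ofLp_injective 2 (Prod.ext ?_ ?_) <;> simp [residual]
    rw [h3]
    refine WithLp.ofLp_injective 2 (Prod.ext rfl ?_)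
    change (lam (k + 1)).snd + _ = _
    rw [h.snd_eq_neg_fst h0]
    rfl
  rw [h2, inner_stack_of_balance, inner_smul_left, RCLike.conj_to_real] at h1
  rw [add_assoc]
  exact h1

end Iterates

/-! ### Contraction of the iterates in the `C`-norm. -/

lemma sqNormC_eq (c : ℝ) (u : EdgePair G p) :
    sqNormC c u = c * ‖u.fst‖ ^ 2 + 1 / c * ‖u.snd‖ ^ 2 := by
  rw [sqNormC, WithLp.prod_inner_apply]
  change ⟪u.fst, c • u.fst⟫ + ⟪u.snd, (1 / c) • u.snd⟫ = _
  rw [inner_smul_right, inner_smul_right, real_inner_self_eq_norm_sq, real_inner_self_eq_norm_sq]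

lemma sqNormC_nonneg (hc : 0 < c) (u : EdgePair G p) : 0 ≤ sqNormC c u := by
  rw [sqNormC_eq]
  positivity

/-- One step of DQM contracts the `C`-norm distance to the optimal pair, for every upper bound `ζ`
of `ζ_k`. -/
lemma IsDQM.step_contraction (hiter : IsDQM G f c x z lam)
    (hinit : InitialCondition G (x 0) (z 0) (lam 0)) (hγ : 0 < gammaU G p) (hm : 0 < m)
    (hmM : m ≤ M) (hc : 0 < c) (hf : HessianBounds f m M) (hL : HessianLipschitz f L)
    {xs : NodeVec n p} {zs αs βs : EdgeVec G p} (hsol : IsSolution G f xs zs)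
    (hmult : IsOptimalMultiplier G f xs zs (WithLp.toLp 2 (αs, βs)))
    (hcol : αs ∈ LinearMap.range (orientedInc G p)) {μ μ' ζ η : ℝ} (hμ : 1 < μ) (hμ' : 1 < μ')
    (hη : 0 < η) {k : ℕ} (hζ : zeta L M x k ≤ ζ) (h1 : ζ / m < η)
    (h2 : η * ζ < c * gammaU G p ^ 2) :
    sqNormC c (WithLp.toLp 2 (z (k + 1), (lam (k + 1)).fst) - WithLp.toLp 2 (zs, αs)) ≤
      1 / (1 + delta c η ζ μ μ' m M (gammaU G p) (GammaU G p) (gammaO G p)) *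
        sqNormC c (WithLp.toLp 2 (z k, (lam k).fst) - WithLp.toLp 2 (zs, αs)) := by
  have hM := hm.trans_le hmM
  have hL0 := hL.nonneg hγ
  have hζ0 : 0 ≤ zeta L M x k := le_min (by positivity) (by positivity)
  have hF := twiceDifferentiable_aggregate fun i => (hf i).1
  have hnn := hessian_aggregate_nonneg hm.le hf
  have hb : ∀ y v, ‖hessian (aggregate f) y v‖ ≤ M * ‖v‖ := fun y v =>
    norm_apply_le_of_nonneg_of_le hM (hnn y) (hessian_aggregate_le hf y) v
  have hsymm : ∀ y, (hessian (aggregate f) y).IsSymmetric := fun y =>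
    ((ContinuousLinearMap.nonneg_iff_isPositive _).1 (hnn y)).isSymmetric
  have hs1 : sourceMat G p xs = zs := sub_eq_zero.1 (congrArg WithLp.fst hsol.1)
  have hs2 : destMat G p xs = zs := sub_eq_zero.1 (congrArg WithLp.snd hsol.1)
  have hOs : orientedInc G p xs = 0 := by
    rw [orientedInc, LinearMap.sub_apply, hs1, hs2, sub_self]
  have hUs : unorientedInc G p xs = (2 : ℝ) • zs := by
    rw [unorientedInc, LinearMap.add_apply, hs1, hs2, two_smul]
  have hU := hiter.unorientedInc_eq hc hinit
  have key := one_step_contraction (μ := μ) (μ' := μ') (unorientedInc G p) (orientedInc G p)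
    hc hm hM hμ hμ' hη (hζ0.trans hζ) hγ (hγ.trans_le (gammaU_le_GammaU G)) (gammaO_pos hγ) h1 h2
    (gammaU_mul_le G) (le_GammaU_mul G)
    (g := gradient (aggregate f) (x (k + 1)) - gradient (aggregate f) xs)
    (e := gradient (aggregate f) (x k) + hessian (aggregate f) (x k) (x (k + 1) - x k)
      - gradient (aggregate f) (x (k + 1)))
    (dx := x (k + 1) - xs) (ds := x (k + 1) - x k) (a := (lam (k + 1)).fst - αs)
    (da := (lam (k + 1)).fst - (lam k).fst) (b := z (k + 1) - zs) (dz := z (k + 1) - z k)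
    (fun v => by
      have h3 := hiter.stationary hinit hsymm k v
      have h4 := stationary_of_isOptimalMultiplier (fun i => (hf i).1.1) hmult v
      simp only [inner_add_left, inner_sub_left] at h3 ⊢
      linarith)
    (by rw [hiter.fst_succ hc hinit, add_sub_cancel_left, map_sub, hOs, sub_zero])
    (by rw [map_sub, hU, hUs, smul_sub])
    (by rw [map_sub, hU, hU, smul_sub])
    ((norm_gradient_model_error_le hm hM hL0 hf hL _ _).trans
      (mul_le_mul_of_nonneg_right hζ (norm_nonneg _)))
    (norm_gradient_sub_le hF hb _ _)
    (strongly_monotone_gradient hF (le_hessian_aggregate hf) _ _)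
    (exists_map_eq_of_mem_range _ (sub_mem (hiter.fst_mem_range hc hinit (k + 1)) hcol))
  -- New error minus increment is the old error, for both `z` and `α`.
  rw [sub_sub_sub_cancel_left, sub_sub_sub_cancel_left] at key
  rw [sqNormC_eq, sqNormC_eq]
  exact key

end DQM

end

theorem theorem1 {n p : ℕ} (G : SimpleGraph (Fin n)) [DecidableRel G.Adj] (hG : G.Connected)
    (hγ : 0 < DQM.gammaU G p)
    (f : Fin n → DQM.Loc p → ℝ) (m M L c : ℝ)
    (hm : 0 < m) (hmM : m ≤ M) (hc : 0 < c)
    (hf : DQM.HessianBounds f m M) (hL : DQM.HessianLipschitz f L)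
    -- the DQM iterates
    (x : ℕ → DQM.NodeVec n p) (z : ℕ → DQM.EdgeVec G p) (lam : ℕ → DQM.EdgePair G p)
    (hiter : DQM.IsDQM G f c x z lam) (hinit : DQM.InitialCondition G (x 0) (z 0) (lam 0))
    -- the solution and the optimal multiplier in the column space of `E_o`
    (xs : DQM.NodeVec n p) (zs : DQM.EdgeVec G p) (αs : DQM.EdgeVec G p)
    (hsol : DQM.IsSolution G f xs zs)
    (hmult : ∃ βs : DQM.EdgeVec G p,
      DQM.IsOptimalMultiplier G f xs zs (WithLp.toLp 2 (αs, βs)))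
    (hcol : αs ∈ LinearMap.range (DQM.orientedInc G p))
    -- `u k = [z k; α k]` and `us = [zs; αs]`
    (u : ℕ → DQM.EdgePair G p) (hu : ∀ k, u k = WithLp.toLp 2 (z k, (lam k).fst))
    (us : DQM.EdgePair G p) (hus : us = WithLp.toLp 2 (zs, αs))
    (μ μ' : ℝ) (hμ : 1 < μ) (hμ' : 1 < μ') :
    -- the step from `k` to `k + 1`
    (∀ (k : ℕ) (η : ℝ), 0 < η →
      DQM.zeta L M x k ^ 2 / (m * DQM.gammaU G p ^ 2) < c →
      DQM.zeta L M x k / m < η →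
      η * DQM.zeta L M x k < c * DQM.gammaU G p ^ 2 →
      0 < DQM.delta c η (DQM.zeta L M x k) μ μ' m M
          (DQM.gammaU G p) (DQM.GammaU G p) (DQM.gammaO G p) ∧
      DQM.sqNormC c (u (k + 1) - us) ≤
        1 / (1 + DQM.delta c η (DQM.zeta L M x k) μ μ' m M
          (DQM.gammaU G p) (DQM.GammaU G p) (DQM.gammaO G p)) * DQM.sqNormC c (u k - us)) ∧
    -- linear convergence, with a uniform rate from any upper bound of the `ζ k`
    (∀ (ζ η : ℝ), (∀ k, DQM.zeta L M x k ≤ ζ) → 0 < η →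
      ζ ^ 2 / (m * DQM.gammaU G p ^ 2) < c →
      ζ / m < η →
      η * ζ < c * DQM.gammaU G p ^ 2 →
      0 < DQM.delta c η ζ μ μ' m M
          (DQM.gammaU G p) (DQM.GammaU G p) (DQM.gammaO G p) ∧
      (∀ k, DQM.sqNormC c (u (k + 1) - us) ≤
        1 / (1 + DQM.delta c η ζ μ μ' m M
          (DQM.gammaU G p) (DQM.GammaU G p) (DQM.gammaO G p)) * DQM.sqNormC c (u k - us)) ∧
      (∀ k, DQM.sqNormC c (u k - us) ≤
        (1 / (1 + DQM.delta c η ζ μ μ' m M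
          (DQM.gammaU G p) (DQM.GammaU G p) (DQM.gammaO G p))) ^ k
          * DQM.sqNormC c (u 0 - us)) ∧
      Filter.Tendsto (fun k => DQM.sqNormC c (u k - us)) Filter.atTop (𝓝 0)) ∧
    -- `2M` is such an upper bound
    (∀ k, DQM.zeta L M x k ≤ 2 * M) := by
  obtain ⟨βs, hβ⟩ := hmult
  have hgo := DQM.gammaO_pos hγ
  have hGu := hγ.trans_le (DQM.gammaU_le_GammaU (p := p) G)
  have hpos : ∀ {ζ η : ℝ}, 0 < η → ζ / m < η → η * ζ < c * DQM.gammaU G p ^ 2 →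
      0 < DQM.delta c η ζ μ μ' m M (DQM.gammaU G p) (DQM.GammaU G p) (DQM.gammaO G p) :=
    fun hη h1 h2 => DQM.delta_pos hc hm hμ hμ' hη hγ hGu hgo h1 h2
  have hstep : ∀ {ζ η : ℝ} {k : ℕ}, DQM.zeta L M x k ≤ ζ → 0 < η → ζ / m < η →
      η * ζ < c * DQM.gammaU G p ^ 2 → DQM.sqNormC c (u (k + 1) - us) ≤
        1 / (1 + DQM.delta c η ζ μ μ' m M
          (DQM.gammaU G p) (DQM.GammaU G p) (DQM.gammaO G p)) * DQM.sqNormC c (u k - us) :=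
    fun {ζ η k} hζ hη h1 h2 => by
      rw [hu, hu, hus]
      exact hiter.step_contraction hinit hγ hm hmM hc hf hL hsol hβ hcol hμ hμ' hη hζ h1 h2
  -- The per-step claim is the case where the upper bound is `ζ_k` itself.
  refine ⟨fun k η hη _ h1 h2 => ⟨hpos hη h1 h2, hstep le_rfl hη h1 h2⟩,
    fun ζ η hζ hη _ h1 h2 => ?_, fun k => min_le_right _ _⟩
  have hδ := hpos hη h1 h2
  set δ := DQM.delta c η ζ μ μ' m M (DQM.gammaU G p) (DQM.GammaU G p) (DQM.gammaO G p)
  have hr0 : 0 ≤ 1 / (1 + δ) := by positivity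
  have hr1 : 1 / (1 + δ) < 1 := by
    rw [div_lt_one (by positivity)]
    linarith
  have hall : ∀ k, DQM.sqNormC c (u (k + 1) - us) ≤ 1 / (1 + δ) * DQM.sqNormC c (u k - us) :=
    fun k => hstep (hζ k) hη h1 h2
  have hpow : ∀ k, DQM.sqNormC c (u k - us) ≤ (1 / (1 + δ)) ^ k * DQM.sqNormC c (u 0 - us) := by
    intro k
    induction k with
    | zero => simp
    | succ k ih =>
      refine (hall k).trans ?_
      rw [pow_succ', mul_assoc]
      gcongr
  refine ⟨hδ, hall, hpow, squeeze_zero (fun k => DQM.sqNormC_nonneg hc _) hpow ?_⟩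
  simpa using (tendsto_pow_atTop_nhds_zero_of_lt_one hr0 hr1).mul_const
    (DQM.sqNormC c (u 0 - us))
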